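/- Let $I(d)$ denote the graph of the $d$-dimensional hypercube: its vertices are the binary vectors of length $d$, and two vertices are adjacent when they differ in exactly one position. For an integer $k\ge 1$, a $d$-dimensional circuit code of spread $k$ is a simple cycle $C$ in $I(d)$ such that $d_{I(d)}(x,y)\ge\min\{d_C(x,y),k\}$ for all vertices $x,y$ of $C$, where $d_{I(d)}$ and $d_C$ denote the graph distances in $I(d)$ and in the cycle $C$. For $d\ge 2$ let $K(d,k)$ denote the maximum length of a $d$-dimensional circuit code of spread $k$. **Theorem.** For every integer $k\ge 1$, $$\log_2 K(d,k)=d+O(\log^2 d)\qquad\text{as } d\to\infty,$$ with the implied constant depending on $k$ only. In particular, the limit $\nu(k):=\lim_{d\to\infty}\frac{\log_2 K(d,k)}{d}$ exists and equals $1$. -/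

import Mathlib

open Filter Topology Asymptotics

/-- The graph `I(d)` of the `d`-dimensional hypercube: the vertices are the binary vectors of
length `d`, and two of them are adjacent when they differ in exactly one position. -/
def hypercube (d : ℕ) : SimpleGraph (Fin d → ZMod 2) where
  Adj x y := hammingDist x y = 1
  symm := ⟨fun x y h => by rw [hammingDist_comm]; exact h⟩
  loopless := ⟨fun x h => by simp at h⟩

/-- `x` enumerates cyclically the vertices of a `d`-dimensional circuit code of spread `k` and
length `N`: a simple cycle of length `N` in `I(d)` (an injective graph homomorphism from the cycle
graph on `N ≥ 3` vertices) such that `d_{I(d)}(u, v) ≥ min {d_C(u, v), k}` for all vertices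
`u, v` of the cycle `C`. Here `d_C` and `d_{I(d)}` are the graph distances in the cycle and in
the hypercube. -/
structure IsCircuitCode (d k N : ℕ) (x : Fin N → (Fin d → ZMod 2)) : Prop where
  three_le : 3 ≤ N
  injective : Function.Injective x
  adj : ∀ i j, (SimpleGraph.cycleGraph N).Adj i j → (hypercube d).Adj (x i) (x j)
  spread : ∀ i j, min ((SimpleGraph.cycleGraph N).dist i j) k ≤ (hypercube d).dist (x i) (x j)

/-- The set of lengths of `d`-dimensional circuit codes of spread `k`. -/
def circuitLengths (d k : ℕ) : Set ℕ :=
  {N | ∃ x : Fin N → (Fin d → ZMod 2), IsCircuitCode d k N x}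

/-- `K(d, k)`: the maximum length of a `d`-dimensional circuit code of spread `k`. The maximum
exists for all `d ≥ 2`, see `circuitMax_isGreatest`. -/
noncomputable def circuitMax (d k : ℕ) : ℕ := sSup (circuitLengths d k)

theorem circuitLengths_le {d k N : ℕ} (h : N ∈ circuitLengths d k) : N ≤ 2 ^ d := by
  obtain ⟨x, hx⟩ := h
  simpa [ZMod.card] using Fintype.card_le_of_injective x hx.injective

/-- Every square face of the hypercube is a circuit code, of any spread. -/
theorem four_mem_circuitLengths {d : ℕ} (hd : 2 ≤ d) (k : ℕ) : 4 ∈ circuitLengths d k := by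
  have hle : ∀ {u v : Fin d → ZMod 2} (p : (hypercube d).Walk u v),
      hammingDist u v ≤ p.length := by
    intro u v p
    induction p with
    | nil => simp
    | @cons a b c h p ih =>
      have h1 : hammingDist a b = 1 := h
      have := hammingDist_triangle a b c
      rw [SimpleGraph.Walk.length_cons]
      omega
  let S : Fin 4 → Fin 2 → ZMod 2 := ![![0, 0], ![1, 0], ![1, 1], ![0, 1]]
  let x : Fin 4 → Fin d → ZMod 2 := fun i j => if h : (j : ℕ) < 2 then S i ⟨j, h⟩ else 0
  have hS : ∀ i j, hammingDist (x i) (x j) = hammingDist (S i) (S j) := by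
    intro i j
    unfold hammingDist
    symm
    refine Finset.card_bij (fun a _ => Fin.castLE hd a) ?_ ?_ ?_
    · intro a ha
      have h2 : (a : ℕ) < 2 := a.2
      simpa only [x, Finset.mem_filter_univ, Fin.val_castLE, h2, dite_true] using ha
    · intro a _ b _ hab
      exact Fin.castLE_injective hd hab
    · intro b hb
      by_cases hb2 : (b : ℕ) < 2
      · exact ⟨⟨b, hb2⟩, by
          simpa only [x, Finset.mem_filter_univ, hb2, dite_true] using hb, rfl⟩
      · simp only [x, Finset.mem_filter_univ, hb2, dite_false, ne_eq, not_true_eq_false] at hb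
  have hadj : ∀ i j, (SimpleGraph.cycleGraph 4).Adj i j → (hypercube d).Adj (x i) (x j) := by
    intro i j h
    change hammingDist (x i) (x j) = 1
    rw [hS]
    revert i j
    decide
  have hconn : ∀ i j, (SimpleGraph.cycleGraph 4).dist i j ≤ hammingDist (S i) (S j) := by
    intro i j
    by_cases hij : i = j
    · subst hij; simp
    by_cases ha : (SimpleGraph.cycleGraph 4).Adj i j
    · rw [SimpleGraph.dist_eq_one_iff_adj.2 ha]
      revert i j; decide
    · have h2 : ∀ i j : Fin 4, i ≠ j → ¬ (SimpleGraph.cycleGraph 4).Adj i j →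
          2 ≤ hammingDist (S i) (S j) ∧ (SimpleGraph.cycleGraph 4).Adj i (i + 1) ∧
            (SimpleGraph.cycleGraph 4).Adj (i + 1) j := by decide
      obtain ⟨h, a, b⟩ := h2 i j hij ha
      exact (SimpleGraph.dist_le (a.toWalk.append b.toWalk)).trans (by simpa using h)
  have hreach : ∀ i j, (hypercube d).Reachable (x i) (x j) := fun i j =>
    (SimpleGraph.cycleGraph_connected.preconnected i j).map ⟨x, fun {a b} h => hadj a b h⟩
  refine ⟨x, by norm_num, ?_, hadj, ?_⟩
  · intro i j h
    have : hammingDist (S i) (S j) = 0 := by rw [← hS, h, hammingDist_self]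
    have h2 : ∀ i j : Fin 4, hammingDist (S i) (S j) = 0 → i = j := by decide
    exact h2 i j this
  · intro i j
    obtain ⟨p, hp⟩ := (hreach i j).exists_walk_length_eq_dist
    exact (min_le_left _ _).trans ((hconn i j).trans (by rw [← hS, ← hp]; exact hle p))

theorem circuitMax_isGreatest {d : ℕ} (hd : 2 ≤ d) (k : ℕ) :
    IsGreatest (circuitLengths d k) (circuitMax d k) :=
  have hb : BddAbove (circuitLengths d k) := ⟨2 ^ d, fun _ h => circuitLengths_le h⟩
  ⟨Nat.sSup_mem ⟨4, four_mem_circuitLengths hd k⟩ hb, fun _ h => le_csSup hb h⟩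

/-! A code has at most `2 ^ d` vertices, so only a lower bound is needed. Take a Gray code `m` of
the `n`-cube and a label `lam` with `L` bits, logarithmic in `n` for fixed `k`, that keeps distinct
vertices within distance `k + 6` at least `k` apart (`exists_spread_label`: power sums and
Vandermonde, then repetition). Add `8 * L` coordinates: four slots, each with two copies of a label.
Between two Gray steps one slot is rewritten bit by bit, and exactly one of the two copies flips at
each bit (`exists_dualLabel_ne_iff`), so the result is a walk in the cube.

Over at most two blocks of `L + 1` steps no coordinate flips twice, so the walk recedes at full
speed. At larger separation either the Gray vertices are `k` apart, or both times have a slot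
holding complete labels of distinct nearby vertices, which are `k` apart. Hence `2 ^ (d - 8 * L) ≤
circuitMax d k`, a loss of only `O(log d)` in the exponent. -/

/-! ### Circuit codes from periodic walks. -/

theorem hammingDist_le_length {d : ℕ} {u v : Fin d → ZMod 2} (p : (hypercube d).Walk u v) :
    hammingDist u v ≤ p.length := by
  induction p with
  | nil => simp
  | @cons a b c h p ih =>
    have h1 : hammingDist a b = 1 := h
    have := hammingDist_triangle a b c
    rw [SimpleGraph.Walk.length_cons]
    omega

theorem cycleGraph_adj_natCast {N : ℕ} [NeZero N] (hN : 3 ≤ N) (a : ℕ) :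
    (SimpleGraph.cycleGraph N).Adj (Fin.ofNat N a) (Fin.ofNat N (a + 1)) := by
  rw [SimpleGraph.cycleGraph_adj']
  right
  rw [Fin.sub_def]
  simp only [Fin.val_ofNat]
  have h1 := Nat.mod_lt a (show 0 < N by omega)
  rw [Nat.add_mod a 1, Nat.mod_eq_of_lt (show 1 < N by omega)]
  by_cases h : a % N + 1 = N
  · rw [h, Nat.mod_self, Nat.add_zero, Nat.mod_eq_of_lt (by omega)]; omega
  · rw [Nat.mod_eq_of_lt (show a % N + 1 < N by omega),
      show N - a % N + (a % N + 1) = 1 + N by omega, Nat.add_mod_right,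
      Nat.mod_eq_of_lt (by omega)]

theorem cycleGraph_dist_natCast_le {N : ℕ} [NeZero N] (hN : 3 ≤ N) (a c : ℕ) :
    (SimpleGraph.cycleGraph N).dist (Fin.ofNat N a) (Fin.ofNat N (a + c)) ≤ c := by
  suffices ∃ p : (SimpleGraph.cycleGraph N).Walk (Fin.ofNat N a) (Fin.ofNat N (a + c)),
      p.length = c by
    obtain ⟨p, hp⟩ := this
    exact (SimpleGraph.dist_le p).trans_eq hp
  induction c with
  | zero => exact ⟨.nil, rfl⟩
  | succ c ih =>
    obtain ⟨p, hp⟩ := ih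
    exact ⟨p.concat (cycleGraph_adj_natCast hN (a + c)), by simp [hp]⟩

/-- A periodic walk in the hypercube that moves away at full speed, up to distance `k`, over half
a period runs through a circuit code of spread `k`. -/
theorem mem_circuitLengths_of_periodic {d k M : ℕ} (hk : 1 ≤ k) (hM : 3 ≤ M)
    (y : ℕ → Fin d → ZMod 2) (hper : ∀ a, y (a + M) = y a)
    (hstep : ∀ a, hammingDist (y a) (y (a + 1)) = 1)
    (hfar : ∀ a c, 2 * c ≤ M → min c k ≤ hammingDist (y a) (y (a + c))) :
    M ∈ circuitLengths d k := by
  have : NeZero M := ⟨by omega⟩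
  have hmod : ∀ a, y (a % M) = y a := fun a =>
    (Function.Periodic.map_mod_nat (f := y) (a := M) hper a)
  have hadj : ∀ i j : Fin M, (SimpleGraph.cycleGraph M).Adj i j →
      (hypercube d).Adj (y i) (y j) := by
    have key : ∀ i j : Fin M, (j - i).val = 1 → hammingDist (y i) (y j) = 1 := by
      intro i j h
      have h1 : j = i + (j - i) := by abel
      have h2 : y j = y (i + 1) := by
        rw [h1, Fin.val_add, h, hmod]
      rw [h2, hstep]
    intro i j h
    rw [SimpleGraph.cycleGraph_adj'] at h
    rcases h with h | h
    · exact (hammingDist_comm _ _).trans (key _ _ h)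
    · exact key _ _ h
  have hreach : ∀ i j : Fin M, (SimpleGraph.cycleGraph M).Reachable i j := by
    obtain ⟨M, rfl⟩ : ∃ m, M = m + 1 := ⟨M - 1, by omega⟩
    exact SimpleGraph.cycleGraph_connected.preconnected
  have hdist : ∀ i j : Fin M, hammingDist (y i) (y j) ≤ (hypercube d).dist (y i) (y j) := by
    intro i j
    have : (hypercube d).Reachable (y i) (y j) :=
      (hreach i j).map ⟨fun i : Fin M => y i, fun {a b} h => hadj a b h⟩
    obtain ⟨p, hp⟩ := this.exists_walk_length_eq_dist
    exact hp ▸ hammingDist_le_length p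
  have hsp : ∀ i j : Fin M, i ≤ j →
      min ((SimpleGraph.cycleGraph M).dist i j) k ≤ hammingDist (y i) (y j) := by
    intro i j hij
    have hij' : (i : ℕ) ≤ j := hij
    have hi := i.2
    have hj := j.2
    have ei : Fin.ofNat M (i : ℕ) = i := by ext; simp
    have ej : Fin.ofNat M (j : ℕ) = j := by ext; simp
    by_cases h : 2 * ((j : ℕ) - i) ≤ M
    · have h1 := cycleGraph_dist_natCast_le hM i (j - i)
      have h2 := hfar i (j - i) h
      rw [Nat.add_sub_cancel' hij'] at h1 h2
      rw [ei, ej] at h1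
      omega
    -- The other arc, from `j` on to `i + M`, is the one within half a period.
    · have h1 := cycleGraph_dist_natCast_le hM j (i + M - j)
      have h2 := hfar j (i + M - j) (by omega)
      rw [show (j : ℕ) + (i + M - j) = i + M by omega] at h1 h2
      have ei' : Fin.ofNat M (i + M : ℕ) = i := by ext; simp [Nat.mod_eq_of_lt hi]
      rw [ei', ej, SimpleGraph.dist_comm] at h1
      rw [hper, hammingDist_comm] at h2
      omega
  have hsp' : ∀ i j : Fin M,
      min ((SimpleGraph.cycleGraph M).dist i j) k ≤ hammingDist (y i) (y j) := by
    intro i j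
    rcases le_total i j with h | h
    · exact hsp i j h
    · rw [SimpleGraph.dist_comm, hammingDist_comm]; exact hsp j i h
  refine ⟨fun i => y i, hM, ?_, hadj, fun i j => (hsp' i j).trans (hdist i j)⟩
  intro i j h
  by_contra hne
  have h1 := hsp' i j
  have h2 := (hreach i j).pos_dist_of_ne hne
  have h3 : y i = y j := h
  rw [h3, hammingDist_self] at h1
  omega

/-! ### Gray codes. -/

theorem hammingDist_finCons {n : ℕ} (a b : ZMod 2) (u v : Fin n → ZMod 2) :
    hammingDist (Fin.cons a u : Fin (n + 1) → ZMod 2) (Fin.cons b v) =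
      (if a ≠ b then 1 else 0) + hammingDist u v := by
  simp only [hammingDist, Finset.card_filter, Fin.sum_univ_succ, Fin.cons_zero, Fin.cons_succ]

/-- A Gray code: a Hamiltonian cycle of the hypercube, enumerated periodically. -/
theorem exists_gray_code (n : ℕ) :
    ∃ m : ℕ → Fin (n + 1) → ZMod 2, (∀ i, hammingDist (m i) (m (i + 1)) = 1) ∧
      ∀ i j, m i = m j ↔ i ≡ j [MOD 2 ^ (n + 1)] := by
  induction n with
  | zero =>
    refine ⟨fun i _ => (i : ZMod 2), fun i => ?_, fun i j => ?_⟩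
    · simp [hammingDist]
    · rw [funext_iff]
      simp [ZMod.natCast_eq_natCast_iff]
  | succ n ih =>
    obtain ⟨m, hstep, hinj⟩ := ih
    -- The new bit runs through 0, 1, 1, 0 and flips in alternation with the steps of the old code.
    -- Together with the parity of `i / 2` it determines the parity of `i`.
    refine ⟨fun i => Fin.cons (((i + 1) / 2 : ℕ) : ZMod 2) (m (i / 2)), fun i => ?_,
      fun i j => ?_⟩
    · rw [hammingDist_finCons]
      rcases Nat.even_or_odd' i with ⟨c, rfl | rfl⟩
      · rw [show (2 * c + 1) / 2 = c by omega, show (2 * c + 1 + 1) / 2 = c + 1 by omega,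
          show 2 * c / 2 = c by omega]
        simp
      · rw [show (2 * c + 1 + 1) / 2 = c + 1 by omega,
          show (2 * c + 1 + 1 + 1) / 2 = c + 1 by omega,
          show (2 * c + 1) / 2 = c by omega]
        simp [hstep]
    · rw [Fin.cons_inj, hinj, ZMod.natCast_eq_natCast_iff, pow_succ 2 (n + 1)]
      have h2 : 2 ∣ 2 ^ (n + 1) := Dvd.intro_left _ rfl
      constructor
      · rintro ⟨h, h'⟩
        have h'' := h'.of_dvd h2
        have h3 := (Nat.ModEq.mul_left' 2 h')
        rw [mul_comm 2 (2 ^ (n + 1))] at h3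
        unfold Nat.ModEq at h h''
        rw [← Nat.div_add_mod i 2, ← Nat.div_add_mod j 2, show i % 2 = j % 2 by omega]
        exact h3.add_right _
      · intro h
        have h3 : i % 2 = j % 2 := h.of_dvd (Dvd.intro_left _ rfl)
        have h4 : i / 2 ≡ j / 2 [MOD 2 ^ (n + 1)] := by
          rw [← Nat.div_add_mod i 2, ← Nat.div_add_mod j 2, h3, mul_comm _ 2] at h
          exact Nat.ModEq.mul_left_cancel' (by norm_num) (h.add_right_cancel' _)
        refine ⟨?_, h4⟩
        have h5 : i / 2 % 2 = j / 2 % 2 := h4.of_dvd h2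
        unfold Nat.ModEq
        omega

/-! ### Short labels separating nearby vertices. -/

/-- The power sums of the support tell apart binary vectors that are close to each other. -/
theorem eq_of_sum_val_mul_pow_eq {n D : ℕ} {u v : Fin n → ZMod 2} (hD : hammingDist u v ≤ D)
    (h : ∀ t < D, ∑ j, (u j).val * (j : ℕ) ^ t = ∑ j, (v j).val * (j : ℕ) ^ t) : u = v := by
  set T : Finset (Fin n) := {j | u j ≠ v j} with hT
  let e := T.equivFin
  have hc : T.card ≤ D := hD
  -- On the at most `D` positions where `u` and `v` differ, the integer differences solve a
  -- homogeneous Vandermonde system with distinct nodes.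
  have key : (fun i => (((u (e.symm i)).val : ℤ) - (v (e.symm i)).val)) = 0 := by
    refine Matrix.eq_zero_of_forall_pow_sum_mul_pow_eq_zero
      (f := fun i => (((e.symm i : Fin n) : ℕ) : ℤ)) ?_ ?_
    · intro a b hab
      exact e.symm.injective (Subtype.ext (Fin.ext (Int.ofNat_inj.1 hab)))
    · intro t
      have h1 := h t (t.2.trans_le hc)
      have h2 : ∑ j, (((u j).val : ℤ) - (v j).val) * (j : ℤ) ^ (t : ℕ) = 0 := by
        simp only [sub_mul, Finset.sum_sub_distrib]
        rw [sub_eq_zero]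
        exact_mod_cast h1
      rw [← h2, e.symm.sum_comp (fun j : T => (((u j).val : ℤ) - (v j).val) *
        (((j : Fin n) : ℕ) : ℤ) ^ (t : ℕ)), Finset.sum_coe_sort T
        (fun j => (((u j).val : ℤ) - (v j).val) * ((j : ℕ) : ℤ) ^ (t : ℕ))]
      refine Finset.sum_subset (Finset.subset_univ _) fun j _ hj => ?_
      have : u j = v j := by simpa [hT] using hj
      simp [this]
  ext j
  by_contra hne
  have hj : j ∈ T := by simpa [hT, ZMod.val_injective 2 |>.eq_iff] using hne
  have := congrFun key (e ⟨j, hj⟩)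
  simp only [Equiv.symm_apply_apply, Pi.zero_apply, sub_eq_zero] at this
  exact hne (ZMod.val_injective 2 (by exact_mod_cast this))

/-- The label is the list of the first `D` power sums; each is below `2 ^ ((r + 1) * D)`, so `(r +
1) * D` bits suffice for it. -/
theorem exists_separating_label {n D r : ℕ} (hn : n ≤ 2 ^ r) :
    ∃ f : (Fin n → ZMod 2) → Fin ((r + 1) * D * D) → ZMod 2,
      ∀ u v, u ≠ v → hammingDist u v ≤ D → f u ≠ f v := by
  have hlt : ∀ (u : Fin n → ZMod 2) (t : Fin D),
      ∑ j, (u j).val * (j : ℕ) ^ (t : ℕ) < 2 ^ ((r + 1) * D) := by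
    intro u t
    have h1 : ∀ j ∈ Finset.univ, (u j).val * (j : ℕ) ^ (t : ℕ) ≤ 1 * (2 ^ r) ^ (t : ℕ) := by
      intro j _
      refine Nat.mul_le_mul ?_ (Nat.pow_le_pow_left (j.2.le.trans hn) _)
      have := ZMod.val_lt (u j)
      omega
    have h2 := Finset.sum_le_card_nsmul _ _ _ h1
    rw [Finset.card_univ, Fintype.card_fin, smul_eq_mul, one_mul] at h2
    calc _ ≤ n * (2 ^ r) ^ (t : ℕ) := h2
      _ ≤ 2 ^ r * (2 ^ r) ^ (t : ℕ) := Nat.mul_le_mul_right _ hn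
      _ = 2 ^ (r * (t + 1)) := by ring
      _ < 2 ^ ((r + 1) * D) := by
        refine Nat.pow_lt_pow_right (by norm_num) ?_
        have := t.2
        nlinarith [Nat.mul_le_mul_left r (show (t : ℕ) + 1 ≤ D from this)]
  obtain ⟨e⟩ : Nonempty ((Fin D → Fin (2 ^ ((r + 1) * D))) ↪
      (Fin ((r + 1) * D * D) → ZMod 2)) := by
    refine Function.Embedding.nonempty_of_card_le ?_
    simp [ZMod.card, ← pow_mul]
  refine ⟨fun u => e fun t => ⟨_, hlt u t⟩, fun u v huv hD h => huv ?_⟩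
  refine eq_of_sum_val_mul_pow_eq hD fun t ht => ?_
  simpa using congrFun (e.injective h) ⟨t, ht⟩

/-- Repeating each bit of a separating label `k` times turns one difference into `k`. -/
theorem exists_spread_label {n D r : ℕ} (k : ℕ) (hn : n ≤ 2 ^ r) :
    ∃ f : (Fin n → ZMod 2) → Fin ((r + 1) * D * D * k) → ZMod 2,
      ∀ u v, u ≠ v → hammingDist u v ≤ D → k ≤ hammingDist (f u) (f v) := by
  obtain ⟨f, hf⟩ := exists_separating_label (D := D) hn
  refine ⟨fun u p => f u (finProdFinEquiv.symm p).1, fun u v huv hD => ?_⟩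
  obtain ⟨i, hi⟩ := Function.ne_iff.1 (hf u v huv hD)
  have := Finset.card_le_card_of_injOn (s := (Finset.univ : Finset (Fin k)))
    (t := {p | f u (finProdFinEquiv.symm p).1 ≠ f v (finProdFinEquiv.symm p).1})
    (fun a => finProdFinEquiv (i, a)) (fun a _ => by
      simpa only [Finset.coe_filter_univ, Set.mem_ofPred_eq, Equiv.symm_apply_apply] using hi)
    (fun a _ b _ h => by simpa using h)
  simpa [hammingDist] using this

/-! ### Distances along walks and counting of flips. -/

/-- If a walk flips pairwise distinct coordinates, it moves away from its start at full speed. -/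
theorem le_hammingDist_of_injOn {ι : Type*} [Fintype ι] (y : ℕ → ι → ZMod 2)
    (f : ℕ → ι) (hf : ∀ t c, y t c ≠ y (t + 1) c ↔ c = f t) (a c : ℕ)
    (hinj : ∀ s t, a ≤ s → s < t → t < a + c → f s ≠ f t) :
    c ≤ hammingDist (y a) (y (a + c)) := by
  have hconst : ∀ x s e, (∀ t, s ≤ t → t < s + e → f t ≠ x) → y s x = y (s + e) x := by
    intro x s e
    induction e with
    | zero => intro _; rfl
    | succ e ih =>
      intro h
      rw [ih fun t h1 h2 => h t h1 (by omega)]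
      by_contra hne
      exact h (s + e) (by omega) (by omega) ((hf (s + e) x).1 hne).symm
  have := Finset.card_le_card_of_injOn (s := Finset.range c)
    (t := {x | y a x ≠ y (a + c) x}) (fun s => f (a + s)) ?_ ?_
  · simpa [hammingDist] using this
  · intro s hs
    have hs' : s < c := by simpa using hs
    have h1 := hconst (f (a + s)) a s fun t h1 h2 => hinj t (a + s) h1 h2 (by omega)
    have h2 := hconst (f (a + s)) (a + s + 1) (c - s - 1) fun t h1 h2 =>
      (hinj (a + s) t (by omega) (by omega) (by omega)).symm
    rw [show a + s + 1 + (c - s - 1) = a + c by omega] at h2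
    simp only [Finset.coe_filter_univ, Set.mem_ofPred_eq]
    rw [h1, ← h2]
    exact (hf _ _).2 rfl
  · intro s hs t ht h
    have hs' : s < c := by simpa using hs
    have ht' : t < c := by simpa using ht
    rcases lt_trichotomy s t with hst | hst | hst
    · exact absurd h (hinj _ _ (by omega) (by omega) (by omega))
    · exact hst
    · exact absurd h.symm (hinj _ _ (by omega) (by omega) (by omega))

theorem hammingDist_comp_le {ι κ : Type*} [Fintype ι] [Fintype κ] (g : κ → ι)
    (hg : Function.Injective g) (u v : ι → ZMod 2) :
    hammingDist (u ∘ g) (v ∘ g) ≤ hammingDist u v :=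
  Finset.card_le_card_of_injOn g (fun a ha => by simpa using ha) hg.injOn

theorem hammingDist_comp_equiv {ι κ : Type*} [Fintype ι] [Fintype κ] (e : κ ≃ ι)
    (u v : ι → ZMod 2) : hammingDist (u ∘ e) (v ∘ e) = hammingDist u v := by
  refine (hammingDist_comp_le e e.injective u v).antisymm ?_
  simpa [Function.comp_assoc] using
    hammingDist_comp_le e.symm e.symm.injective (u ∘ e) (v ∘ e)

/-- How often the coordinate of phase `φ` has been flipped before time `t`, if it is flipped
once in `q` steps. -/
def flipCount (q φ t : ℕ) : ℕ := (t + (q - 1 - φ)) / q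

theorem flipCount_succ {q φ t : ℕ} (hφ : φ < q) :
    flipCount q φ (t + 1) = flipCount q φ t + if t % q = φ then 1 else 0 := by
  unfold flipCount
  rw [show t + 1 + (q - 1 - φ) = t + (q - 1 - φ) + 1 by omega, Nat.succ_div]
  congr 1
  have hq : 0 < q := by omega
  have h1 := Nat.mod_lt t hq
  have h2 := Nat.div_add_mod t q
  have : (q ∣ t + (q - 1 - φ) + 1) ↔ t % q = φ := by
    rw [show t + (q - 1 - φ) + 1 = q * (t / q) + (t % q + (q - φ)) by omega,
      Nat.dvd_add_right (Dvd.intro _ rfl)]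
    constructor
    · rintro ⟨c, hc⟩
      have h3 : c = 1 := by
        have : 0 < c := by
          rcases Nat.eq_zero_or_pos c with rfl | h
          · omega
          · exact h
        have : c < 2 := by
          by_contra h
          have := Nat.mul_le_mul_left q (show 2 ≤ c by omega)
          omega
        omega
      subst h3
      omega
    · intro h
      exact ⟨1, by omega⟩
  simp only [this]

theorem flipCount_add_mul {q φ t : ℕ} (hφ : φ < q) (c : ℕ) :
    flipCount q φ (t + c * q) = flipCount q φ t + c := by
  unfold flipCount
  rw [show t + c * q + (q - 1 - φ) = t + (q - 1 - φ) + c * q by ring,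
    Nat.add_mul_div_right _ _ (by omega)]

theorem flipCount_eq {q φ t c : ℕ} (h1 : c * q + φ < t + q) (h2 : t ≤ c * q + φ) (hφ : φ < q) :
    flipCount q φ t = c := by
  unfold flipCount
  rw [Nat.div_eq_iff (by omega)]
  constructor <;> omega

/-! ### The labelled walk. -/

section Walk

variable {n L : ℕ} (m : ℕ → Fin n → ZMod 2) (lam : (Fin n → ZMod 2) → Fin L → ZMod 2)

/-- The label of the `i`-th vertex of `m`; the copy `x = true` flips between the times `i` and
`i + 4` exactly where the copy `x = false` does not. -/
def dualLabel (i : ℕ) (x : Bool) (p : Fin L) : ZMod 2 :=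
  lam (m i) p + if x then ((i / 4 : ℕ) : ZMod 2) else 0

/-- The walk that follows `m` and, between any two of its steps, replaces one of four stored
labels by the one that is due four steps later. -/
def labelledWalk (t : ℕ) : Fin n ⊕ (Fin 4 × Bool × Fin L) → ZMod 2 :=
  Sum.elim (m (t / (L + 1))) fun c =>
    dualLabel m lam (c.1 + 4 * flipCount (4 * (L + 1)) (c.1 * (L + 1) + c.2.2) t) c.2.1 c.2.2

/-- The copies differ by the parity of `i / 4`, which changes from `i` to `i + 4`. Rewriting a bit
therefore costs one flip whatever the two labels are, and the timing of the walk is rigid. -/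
theorem exists_dualLabel_ne_iff (i : ℕ) (p : Fin L) :
    ∃ x, ∀ x', dualLabel m lam i x' p ≠ dualLabel m lam (i + 4) x' p ↔ x' = x := by
  have key : ∀ a b q : ZMod 2, (a ≠ b ∧ a + q = b + (q + 1)) ∨
      (a = b ∧ a + q ≠ b + (q + 1)) := by decide
  have h4 : (i + 4) / 4 = i / 4 + 1 := by omega
  rcases key (lam (m i) p) (lam (m (i + 4)) p) ((i / 4 : ℕ) : ZMod 2) with h | h
  · refine ⟨false, fun x' => ?_⟩
    cases x' <;> simp [dualLabel, h4, h.1, h.2]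
  · refine ⟨true, fun x' => ?_⟩
    cases x'
    · simp [dualLabel, h.1]
    · simpa [dualLabel, h4] using h.2

theorem phase_lt (b : Fin 4) (p : Fin L) : (b : ℕ) * (L + 1) + p < 4 * (L + 1) := by
  have h1 := b.2
  have h2 := p.2
  nlinarith [Nat.mul_le_mul_right (L + 1) (show (b : ℕ) ≤ 3 by omega)]

variable {m lam}

theorem mod_eq_phase_iff (t : ℕ) (b : Fin 4) (p : Fin L) :
    t % (4 * (L + 1)) = b * (L + 1) + p ↔ t / (L + 1) % 4 = b ∧ t % (L + 1) = p := by
  rw [mul_comm 4, Nat.mod_mul]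
  have hp := p.2
  have h1 := Nat.mod_lt t (show 0 < L + 1 by omega)
  constructor
  · intro h
    have h2 : t % (L + 1) = p := by
      have := congrArg (· % (L + 1)) h
      simpa [Nat.mod_eq_of_lt (show (p : ℕ) < L + 1 by omega), Nat.mul_add_mod'] using this
    refine ⟨?_, h2⟩
    rw [h2, mul_comm, add_comm] at h
    exact Nat.eq_of_mul_eq_mul_right (show 0 < L + 1 by omega) (Nat.add_right_cancel h)
  · rintro ⟨h, h'⟩
    rw [h, h']; ring

/-- The quotient of `t` by `L + 1` is the current Gray index, and modulo 4 it names the slot being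
rewritten. The remainder is the bit position; the remainder `L` is reserved for the Gray step. -/
theorem exists_flip (hstep : ∀ i, hammingDist (m i) (m (i + 1)) = 1) (t : ℕ) :
    ∃ f, (∀ c, labelledWalk m lam t c ≠ labelledWalk m lam (t + 1) c ↔ c = f) ∧
      (∀ j, f = .inl j → t % (L + 1) = L ∧
        m (t / (L + 1)) j ≠ m (t / (L + 1) + 1) j ∧
        ∀ j', m (t / (L + 1)) j' ≠ m (t / (L + 1) + 1) j' → j' = j) ∧
      ∀ b x p, f = .inr (b, x, p) → t / (L + 1) % 4 = b ∧ t % (L + 1) = p := by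
  have hr : ∀ b x p, labelledWalk m lam t (.inr (b, x, p)) ≠
      labelledWalk m lam (t + 1) (.inr (b, x, p)) ↔
      (t / (L + 1) % 4 = b ∧ t % (L + 1) = p) ∧
        dualLabel m lam (b + 4 * flipCount (4 * (L + 1)) (b * (L + 1) + p) t) x p ≠
        dualLabel m lam (b + 4 * flipCount (4 * (L + 1)) (b * (L + 1) + p) t + 4) x p := by
    intro b x p
    simp only [labelledWalk, Sum.elim_inr]
    rw [flipCount_succ (phase_lt b p), ← mod_eq_phase_iff]
    split_ifs with h
    · rw [and_iff_right h, mul_add_one 4 (flipCount _ _ _), ← add_assoc]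
    · simp [h]
  have h1 := Nat.mod_lt t (show 0 < L + 1 by omega)
  by_cases ht : t % (L + 1) = L
  · obtain ⟨j, hj⟩ := Finset.card_eq_one.1 (hstep (t / (L + 1)))
    have hj' : ∀ j', m (t / (L + 1)) j' ≠ m (t / (L + 1) + 1) j' ↔ j' = j := fun j' => by
      simpa using Finset.ext_iff.1 hj j'
    refine ⟨.inl j, ?_, ?_, ?_⟩
    · rintro (j' | ⟨b, x, p⟩)
      · have : (t + 1) / (L + 1) = t / (L + 1) + 1 := by
          rw [Nat.succ_div, if_pos]
          rw [Nat.dvd_iff_mod_eq_zero, Nat.add_mod, ht]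
          rcases L with _ | L
          · simp
          · rw [Nat.mod_eq_of_lt (show 1 < L + 1 + 1 by omega), Nat.mod_self]
        simpa [labelledWalk, this] using hj' j'
      · rw [hr]
        have := p.2
        simp only [reduceCtorEq, iff_false, not_and]
        omega
    · intro j' h
      obtain rfl : j = j' := Sum.inl_injective h
      exact ⟨ht, (hj' j).2 rfl, fun j' => (hj' j').1⟩
    · simp
  · set b : Fin 4 := ⟨t / (L + 1) % 4, Nat.mod_lt _ (by norm_num)⟩ with hb
    set p : Fin L := ⟨t % (L + 1), by omega⟩ with hp
    obtain ⟨x, hx⟩ := exists_dualLabel_ne_iff m lam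
      (b + 4 * flipCount (4 * (L + 1)) (b * (L + 1) + p) t) p
    refine ⟨.inr (b, x, p), ?_, by simp, ?_⟩
    · rintro (j' | ⟨b', x', p'⟩)
      · have : (t + 1) / (L + 1) = t / (L + 1) := by
          rw [Nat.succ_div, if_neg, add_zero]
          rintro ⟨c, hc⟩
          apply ht
          have : t = L + (L + 1) * (c - 1) := by
            rcases c with _ | c
            · omega
            · simp only [Nat.add_sub_cancel, mul_add] at hc ⊢; omega
          rw [this, Nat.add_mul_mod_self_left, Nat.mod_eq_of_lt (by omega)]
        simp [labelledWalk, this]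
      · rw [hr]
        constructor
        · rintro ⟨⟨h1, h2⟩, h3⟩
          obtain rfl : b' = b := Fin.ext h1.symm
          obtain rfl : p' = p := Fin.ext h2.symm
          rw [(hx x').1 h3]
        · intro h
          simp only [Sum.inr.injEq, Prod.mk.injEq] at h
          obtain ⟨rfl, rfl, rfl⟩ := h
          exact ⟨⟨rfl, rfl⟩, (hx _).2 rfl⟩
    · intro b' x' p' h
      simp only [Sum.inr.injEq, Prod.mk.injEq] at h
      obtain ⟨rfl, rfl, rfl⟩ := h
      exact ⟨rfl, rfl⟩

theorem hammingDist_labelledWalk_succ (hstep : ∀ i, hammingDist (m i) (m (i + 1)) = 1) (t : ℕ) :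
    hammingDist (labelledWalk m lam t) (labelledWalk m lam (t + 1)) = 1 := by
  obtain ⟨f, hf, -⟩ := exists_flip (lam := lam) hstep t
  exact Finset.card_eq_one.2 ⟨f, by ext c; simpa using hf c⟩

/-- Within `2 * (L + 1)` steps a remainder modulo `L + 1` can recur only in the next block. There
another slot is active, and two consecutive Gray steps in one direction would cancel, against `h2`.
-/
theorem le_hammingDist_labelledWalk_near (hstep : ∀ i, hammingDist (m i) (m (i + 1)) = 1)
    (h2 : ∀ i, m i ≠ m (i + 2)) (a c : ℕ) (hc : c ≤ 2 * (L + 1)) :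
    c ≤ hammingDist (labelledWalk m lam a) (labelledWalk m lam (a + c)) := by
  choose f hf hl hr using exists_flip (lam := lam) hstep
  refine le_hammingDist_of_injOn _ f hf a c fun s t has hst htc hfst => ?_
  have ds := Nat.div_add_mod s (L + 1)
  have dt := Nat.div_add_mod t (L + 1)
  have key : s % (L + 1) = t % (L + 1) → t / (L + 1) = s / (L + 1) + 1 := by
    intro h
    have h1 : (L + 1) * (s / (L + 1)) < (L + 1) * (t / (L + 1)) := by omega
    have h3 : (L + 1) * (t / (L + 1)) < (L + 1) * (s / (L + 1) + 2) := by
      rw [mul_add]; omega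
    have := Nat.lt_of_mul_lt_mul_left h1
    have := Nat.lt_of_mul_lt_mul_left h3
    omega
  rcases hs : f s with j | ⟨b, x, p⟩
  · obtain ⟨s1, s2, s3⟩ := hl s j hs
    obtain ⟨t1, t2, t3⟩ := hl t j (hfst ▸ hs)
    rw [key (by omega)] at t2 t3
    refine h2 (s / (L + 1)) (funext fun j' => ?_)
    have tri : ∀ u v w : ZMod 2, u ≠ v → v ≠ w → u = w := by decide
    by_cases hj : j' = j
    · subst hj
      exact tri _ _ _ s2 t2
    · have e1 := not_not.1 fun h => hj (s3 j' h)
      have e2 := not_not.1 fun h => hj (t3 j' h)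
      exact e1.trans e2
  · obtain ⟨s1, s2⟩ := hr s b x p hs
    obtain ⟨t1, t2⟩ := hr t b x p (hfst ▸ hs)
    have := key (by omega)
    omega

/-- Slot `e % 4` is rewritten during the blocks `e - 4` and `e`; in the three blocks strictly
between, it holds the whole label of `m e`, in plain form in the copy `false`. -/
theorem labelledWalk_inr_eq {t e : ℕ} (h1 : t / (L + 1) < e) (h2 : e < t / (L + 1) + 4)
    (p : Fin L) :
    labelledWalk m lam t (.inr (⟨e % 4, Nat.mod_lt _ (by norm_num)⟩, false, p)) = lam (m e) p := by
  have hp := p.2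
  have dt := Nat.div_add_mod t (L + 1)
  have ht := Nat.mod_lt t (show 0 < L + 1 by omega)
  have he := Nat.div_add_mod e 4
  have e1 := Nat.mul_le_mul_left (L + 1) (show t / (L + 1) + 1 ≤ e from h1)
  have e2 := Nat.mul_le_mul_left (L + 1) (show e ≤ t / (L + 1) + 3 by omega)
  have e3 : e / 4 * (4 * (L + 1)) + (e % 4 * (L + 1) + p) = (L + 1) * e + p := by
    conv_rhs => rw [← he]
    ring
  rw [mul_add] at e1 e2
  have hN : flipCount (4 * (L + 1)) (e % 4 * (L + 1) + p) t = e / 4 :=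
    flipCount_eq (by omega) (by omega)
      (phase_lt ⟨e % 4, Nat.mod_lt _ (by norm_num)⟩ p)
  simp only [labelledWalk, Sum.elim_inr, hN, Nat.mod_add_div, dualLabel]
  simp

theorem hammingDist_add_le (hstep : ∀ i, hammingDist (m i) (m (i + 1)) = 1) (i c : ℕ) :
    hammingDist (m i) (m (i + c)) ≤ c := by
  induction c with
  | zero => simp
  | succ c ih =>
    have := hammingDist_triangle (m i) (m (i + c)) (m (i + c + 1))
    rw [hstep] at this
    exact this.trans (by omega)

/-- If the current Gray vertices are less than `k` apart, the vertices whose labels are compared lie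
at most 3 steps ahead of each, hence the radius `k + 6`. -/
theorem le_hammingDist_labelledWalk_far {k : ℕ}
    (hstep : ∀ i, hammingDist (m i) (m (i + 1)) = 1)
    (hlam : ∀ u v, u ≠ v → hammingDist u v ≤ k + 6 → k ≤ hammingDist (lam u) (lam v))
    {s t a b : ℕ} (ha : 1 ≤ a) (ha' : a ≤ 3) (hb : 1 ≤ b) (hb' : b ≤ 3)
    (hab : (s / (L + 1) + a) % 4 = (t / (L + 1) + b) % 4)
    (hne : m (s / (L + 1) + a) ≠ m (t / (L + 1) + b)) :
    k ≤ hammingDist (labelledWalk m lam s) (labelledWalk m lam t) := by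
  by_cases hm : k ≤ hammingDist (m (s / (L + 1))) (m (t / (L + 1)))
  · exact hm.trans (hammingDist_comp_le Sum.inl Sum.inl_injective (labelledWalk m lam s)
      (labelledWalk m lam t))
  · have h1 := hammingDist_add_le hstep (s / (L + 1)) a
    have h2 := hammingDist_add_le hstep (t / (L + 1)) b
    rw [hammingDist_comm] at h1
    have h3 := hammingDist_triangle (m (s / (L + 1) + a)) (m (s / (L + 1))) (m (t / (L + 1)))
    have h4 := hammingDist_triangle (m (s / (L + 1) + a)) (m (t / (L + 1))) (m (t / (L + 1) + b))
    refine (hlam _ _ hne (by omega)).trans ?_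
    let g : Fin L → Fin n ⊕ (Fin 4 × Bool × Fin L) := fun p =>
      .inr (⟨(s / (L + 1) + a) % 4, Nat.mod_lt _ (by norm_num)⟩, false, p)
    have hg : Function.Injective g := fun p q h => by simpa [g] using h
    have es : labelledWalk m lam s ∘ g = lam (m (s / (L + 1) + a)) :=
      funext fun p => labelledWalk_inr_eq (by omega) (by omega) p
    have et : labelledWalk m lam t ∘ g = lam (m (t / (L + 1) + b)) := by
      funext p
      simp only [g, Function.comp, hab]
      exact labelledWalk_inr_eq (by omega) (by omega) p
    rw [← es, ← et]
    exact hammingDist_comp_le g hg _ _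

/-- The factor 8 is 4 for the slots times 2 for the parity of `i / 4` in the dual copy. -/
theorem labelledWalk_periodic {c : ℕ} (hm : ∀ i, m (i + 8 * c) = m i) (t : ℕ) :
    labelledWalk m lam (t + 8 * c * (L + 1)) = labelledWalk m lam t := by
  funext x
  rcases x with j | ⟨b, x, p⟩
  · simp [labelledWalk, Nat.add_mul_div_right, hm]
  · simp only [labelledWalk, Sum.elim_inr]
    rw [show 8 * c * (L + 1) = 2 * c * (4 * (L + 1)) by ring, flipCount_add_mul (phase_lt b p)]
    generalize flipCount (4 * (L + 1)) (b * (L + 1) + p) t = N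
    have h2 : (2 : ZMod 2) = 0 := rfl
    have e1 : (b + 4 * (N + 2 * c) : ℕ) = b + 4 * N + 8 * c := by ring
    have e2 : (b + 4 * N + 8 * c : ℕ) / 4 = (b + 4 * N) / 4 + 2 * c := by omega
    simp [dualLabel, e1, e2, hm, h2]

end Walk

/-! ### The lower bound. -/

/-- A label that keeps nearby vertices of the `n`-cube `k` apart yields a circuit code. -/
theorem mem_circuitLengths_of_label {n L k : ℕ} (hn : 3 ≤ n) (hk : 1 ≤ k)
    (lam : (Fin n → ZMod 2) → Fin L → ZMod 2)
    (hlam : ∀ u v, u ≠ v → hammingDist u v ≤ k + 6 → k ≤ hammingDist (lam u) (lam v)) :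
    2 ^ n * (L + 1) ∈ circuitLengths (n + 8 * L) k := by
  obtain ⟨n, rfl⟩ : ∃ n', n = n' + 3 := ⟨n - 3, by omega⟩
  obtain ⟨m, hstep, hm⟩ := exists_gray_code (n + 2)
  let e : Fin (n + 3 + 8 * L) ≃ Fin (n + 3) ⊕ (Fin 4 × Bool × Fin L) :=
    Fintype.equivOfCardEq (by simp; ring)
  have hpow : 2 ^ (n + 3) = 8 * 2 ^ n := by ring
  have hpos : 1 ≤ 2 ^ n := Nat.one_le_two_pow
  have hM : 8 * (L + 1) ≤ 2 ^ (n + 3) * (L + 1) := Nat.mul_le_mul_right _ (by omega)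
  have hne : ∀ i j, i < j → j < i + 2 ^ (n + 3) → m i ≠ m j := by
    intro i j hij hj h
    have h' := ((Nat.modEq_iff_dvd' hij.le).1 ((hm i j).1 h))
    have := Nat.le_of_dvd (by omega) h'
    change 2 ^ (n + 3) ≤ _ at this
    omega
  refine mem_circuitLengths_of_periodic hk (by omega) (fun t => labelledWalk m lam t ∘ e)
    (fun t => ?_) (fun t => ?_) fun a c hc => ?_
  · rw [hpow, labelledWalk_periodic fun i => (hm _ _).2 ?_]
    change i + 8 * 2 ^ n ≡ i [MOD 2 ^ (n + 3)]
    rw [hpow]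
    exact Nat.add_modulus_modEq_iff.2 rfl
  · rw [hammingDist_comp_equiv, hammingDist_labelledWalk_succ hstep]
  · rw [hammingDist_comp_equiv]
    by_cases h : c ≤ 2 * (L + 1)
    · exact (min_le_left _ _).trans (le_hammingDist_labelledWalk_near hstep
        (fun i => hne _ _ (by omega) (by omega)) a c h)
    refine (min_le_right _ _).trans ?_
    have d1 := Nat.div_add_mod a (L + 1)
    have d2 := Nat.div_add_mod (a + c) (L + 1)
    have m1 := Nat.mod_lt a (show 0 < L + 1 by omega)
    have m2 := Nat.mod_lt (a + c) (show 0 < L + 1 by omega)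
    set i := a / (L + 1) with hi
    set j := (a + c) / (L + 1) with hj
    have hij : i + 2 ≤ j := by
      have : (L + 1) * (i + 1) < (L + 1) * j := by rw [mul_add]; omega
      have := Nat.lt_of_mul_lt_mul_left this
      omega
    -- At most half a period separates the times; this keeps `j + q` and `i + p` less than a full
    -- Gray period apart.
    have hji : j ≤ i + 4 * 2 ^ n + 1 := by
      have : (L + 1) * j < (L + 1) * (i + 4 * 2 ^ n + 2) := by
        have : (L + 1) * (i + 4 * 2 ^ n + 2) =
          (L + 1) * i + 4 * (2 ^ n * (L + 1)) + 2 * (L + 1) := by ring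
        rw [hpow, mul_assoc] at hc
        omega
      have := Nat.lt_of_mul_lt_mul_left this
      omega
    -- Both times share a slot with a complete label. The stored indices must also differ: for `j =
    -- i + 2` the pair `(3, 1)` would name one and the same vertex, so `(1, 3)` is taken.
    obtain ⟨p, q, hp, hp', hq, hq', hpq⟩ : ∃ p q : ℕ, 1 ≤ p ∧ p ≤ 3 ∧ 1 ≤ q ∧ q ≤ 3 ∧
        ((i + p) % 4 = (j + q) % 4 ∧ i + p < j + q ∧ j + q < i + p + 2 ^ (n + 3)) := by
      have : (j - i) % 4 < 4 := Nat.mod_lt _ (by norm_num)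
      have : (j - i) % 4 = 0 ∨ (j - i) % 4 = 1 ∨ (j - i) % 4 = 2 ∨ (j - i) % 4 = 3 := by omega
      rcases this with h | h | h | h
      · exact ⟨1, 1, by omega⟩
      · exact ⟨2, 1, by omega⟩
      · exact ⟨1, 3, by omega⟩
      · exact ⟨1, 2, by omega⟩
    exact le_hammingDist_labelledWalk_far hstep hlam hp hp' hq hq' hpq.1 (hne _ _ hpq.2.1 hpq.2.2)

theorem two_pow_le_circuitMax {d k : ℕ} (hk : 1 ≤ k)
    (hd : 8 * ((Nat.log 2 d + 2) * (k + 6) * (k + 6) * k) + 3 ≤ d) :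
    2 ^ (d - 8 * ((Nat.log 2 d + 2) * (k + 6) * (k + 6) * k)) ≤ circuitMax d k := by
  set L := (Nat.log 2 d + 2) * (k + 6) * (k + 6) * k with hL
  -- `L` is computed from `d` instead of `n = d - 8 * L`, which avoids a circular choice.
  have hle : d - 8 * L ≤ 2 ^ (Nat.log 2 d + 1) :=
    (Nat.sub_le _ _).trans (Nat.lt_pow_succ_log_self (by norm_num) d).le
  obtain ⟨lam, hlam⟩ := exists_spread_label (D := k + 6) k hle
  have h := mem_circuitLengths_of_label (by omega) hk lam hlam
  rw [← hL, Nat.sub_add_cancel (by omega)] at h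
  exact (Nat.le_mul_of_pos_right _ (Nat.succ_pos L)).trans
    ((circuitMax_isGreatest (by omega) k).2 h)

/-! ### Asymptotics. -/

theorem theorem1 (k : ℕ) (hk : 1 ≤ k) :
    ((fun d : ℕ => Real.logb 2 (circuitMax d k : ℝ) - (d : ℝ))
        =O[atTop] fun d : ℕ => Real.log (d : ℝ) ^ 2) ∧
      Tendsto (fun d : ℕ => Real.logb 2 (circuitMax d k : ℝ) / (d : ℝ)) atTop (𝓝 1) := by
  have hlog : Tendsto (fun d : ℕ => Real.log (d : ℝ)) atTop atTop :=
    Real.tendsto_log_atTop.comp tendsto_natCast_atTop_atTop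
  have hsq : (fun d : ℕ => Real.log (d : ℝ) ^ 2) =o[atTop] fun d : ℕ => (d : ℝ) :=
    (Real.isLittleO_pow_log_id_atTop (n := 2)).comp_tendsto tendsto_natCast_atTop_atTop
  set K : ℕ := 8 * ((k + 6) * (k + 6) * k) with hK
  have hred : ∀ᶠ d : ℕ in atTop,
      ((K * (Nat.log 2 d + 2) : ℕ) : ℝ) ≤ 4 * K * Real.log (d : ℝ) ^ 2 := by
    filter_upwards [hlog.eventually_ge_atTop 2] with d hd
    have h0 : d ≠ 0 := by rintro rfl; simp at hd; linarith
    have h1 : (Nat.log 2 d : ℝ) ≤ Real.logb 2 d := by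
      rw [Real.le_logb_iff_rpow_le (by norm_num) (by positivity), Real.rpow_natCast]
      exact_mod_cast Nat.pow_log_le_self 2 h0
    have h2 : Real.logb 2 d ≤ 2 * Real.log d := by
      rw [Real.logb, div_le_iff₀ (Real.log_pos (by norm_num))]
      nlinarith [Real.log_two_gt_d9]
    have h3 : (Nat.log 2 d : ℝ) + 2 ≤ 4 * Real.log (d : ℝ) ^ 2 := by nlinarith
    push_cast
    nlinarith [mul_le_mul_of_nonneg_left h3 (Nat.cast_nonneg (α := ℝ) K)]
  have hO : (fun d : ℕ => Real.logb 2 (circuitMax d k : ℝ) - (d : ℝ))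
      =O[atTop] fun d : ℕ => Real.log (d : ℝ) ^ 2 := by
    refine IsBigO.of_bound (4 * K) ?_
    -- With this constant `4 * K * log² d ≤ d / 2`, and `d ≥ 6` leaves room for the extra 3.
    have hsmall := hsq.def (c := (8 * K + 8 : ℝ)⁻¹) (by positivity)
    filter_upwards [hred, hsmall, eventually_ge_atTop 6] with d h1 h2 h6
    have hle : K * (Nat.log 2 d + 2) + 3 ≤ d := by
      rw [Real.norm_of_nonneg (by positivity), Real.norm_of_nonneg (by positivity),
        inv_mul_eq_div, le_div_iff₀ (by positivity)] at h2
      have h6' : (6 : ℝ) ≤ d := by exact_mod_cast h6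
      have : ((K * (Nat.log 2 d + 2) : ℕ) : ℝ) + 3 ≤ d := by
        nlinarith [sq_nonneg (Real.log (d : ℝ))]
      exact_mod_cast this
    have hKL : 8 * ((Nat.log 2 d + 2) * (k + 6) * (k + 6) * k) = K * (Nat.log 2 d + 2) := by
      rw [hK]; ring
    have hlow := two_pow_le_circuitMax (d := d) hk (by rw [hKL]; exact hle)
    rw [hKL] at hlow
    have hup := circuitLengths_le (circuitMax_isGreatest (show 2 ≤ d by omega) k).1
    have hpos : 0 < circuitMax d k := (pow_pos (by norm_num) _).trans_le hlow
    have hpos' : (0 : ℝ) < circuitMax d k := by exact_mod_cast hpos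
    have l1 : ((d - K * (Nat.log 2 d + 2) : ℕ) : ℝ) ≤ Real.logb 2 (circuitMax d k) := by
      rw [Real.le_logb_iff_rpow_le (by norm_num) hpos', Real.rpow_natCast]
      exact_mod_cast hlow
    have l2 : Real.logb 2 (circuitMax d k) ≤ d := by
      rw [Real.logb_le_iff_le_rpow (by norm_num) hpos', Real.rpow_natCast]
      exact_mod_cast hup
    rw [Nat.cast_sub (by omega)] at l1
    rw [Real.norm_of_nonpos (by linarith), Real.norm_of_nonneg (by positivity)]
    linarith
  refine ⟨hO, ?_⟩
  have h0 := (hO.trans_isLittleO hsq).tendsto_div_nhds_zero.const_add 1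
  rw [add_zero] at h0
  refine h0.congr' ?_
  filter_upwards [eventually_ge_atTop 1] with d hd
  have : (d : ℝ) ≠ 0 := by positivity
  field_simp
  ring
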